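/- Conventions. A pair $(N,N_0)$ of a group and a subgroup is a Hecke pair if $[N_0:N_0\cap xN_0x^{-1}]<\infty$ for all $x\in N$, and it is reduced if $\bigcap_{x\in N}xN_0x^{-1}=\{e\}$. A completion of $(N,N_0)$ is a pair $(\bar N,\bar N_0)$ with a homomorphism $\rho\colon N\to\bar N$, where $\bar N$ is a locally compact (Hausdorff) group, $\bar N_0$ is a compact open subgroup, $\rho(N)$ is dense in $\bar N$, $\rho(N_0)$ is dense in $\bar N_0$ and $\rho^{-1}(\bar N_0)=N_0$. The Schlichting completion of a Hecke pair $(N,N_0)$ is the (up to isomorphism unique) pair $(\bar N,\bar N_0)$ with a homomorphism $\phi\colon N\to\bar N$ such that $\bar N$ is a locally compact totally disconnected group, $\bar N_0$ is a compact open subgroup, $(\bar N,\bar N_0)$ is reduced, $\phi(N)$ is dense in $\bar N$ and $\phi^{-1}(\bar N_0)=N_0$. For a locally compact group $\bar V$, $\operatorname{HA}(\bar V)$ is the group of homeomorphic automorphisms of $\bar V$, with the group topology in which the sets $\{\beta:\beta(u)\in Uu,\ \beta^{-1}(u)\in Uu\ \text{for all } u\in K\}$, for $K\subset\bar V$ compact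 and $U$ a neighbourhood of $e$, form a neighbourhood basis at the identity. Semidirect products of topological groups carry the product topology. Theorem. Let a group $G$ act by automorphisms on a group $V$, and let $\Gamma$ be a subgroup of $G$ leaving a subgroup $V_0$ of $V$ invariant. Suppose that $(V\rtimes G,V_0\rtimes\Gamma)$ is a reduced Hecke pair. Let $\bar V$ and $\bar V_0$ be the closures of the images of $V$ and $V_0$ in the Schlichting completion of $(V\rtimes G,V_0)$, and for $g\in G$ let $\operatorname{Ad}g\in\operatorname{HA}(\bar V)$ be conjugation by the image of $g$. Let $(\tilde G,\tilde\Gamma)$ and $\tilde\rho\colon G\to\tilde G$ form a completion of $(G,\Gamma)$. (i) The map $\rho(g):=(\operatorname{Ad}g,\tilde\rho(g))$ is a homomorphism from $G$ into $\operatorname{HA}(\bar V)\times\tilde G$. Put $\bar G:=\overline{\rho(G)}$ and $\bar\Gamma:=\overline{\rho(\Gamma)}$, and let $\bar G$ act on $\bar V$ through the first coordinate. Then $\bar\Gamma$ leaves $\bar V_0$ invariant, and $(\bar V\rtimes\bar G,\bar V_0\rtimes\bar\Gamma)$ together with the homomorphism $\iota\colon V\rtimes G\to\bar V\rtimes\bar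 G$, $\iota(v,g)=(v,\rho(g))$ (where $v$ stands for its image in $\bar V$), is a completion of $(V\rtimes G,V_0\rtimes\Gamma)$. (ii) Suppose in addition that $(\tilde G,\tilde\Gamma)$ with $\tilde\rho$ is the Schlichting completion of $(G,\Gamma)$, and that for every $v\in V$ there is a finite set $\{g_1,\dots,g_n\}\subset G$ such that $\bigcap_{i=1}^n g_i(V_0)\subset vV_0v^{-1}$. Then $(\bar V\rtimes\bar G,\bar V_0\rtimes\bar\Gamma)$ with $\iota$ is the Schlichting completion of $(V\rtimes G,V_0\rtimes\Gamma)$: if $(\overline{V\rtimes G},\overline{V_0\rtimes\Gamma})$ is the Schlichting completion of $(V\rtimes G,V_0\rtimes\Gamma)$, then $\iota$ extends to a topological isomorphism of $\overline{V\rtimes G}$ onto $\bar V\rtimes\bar G$ that carries $\overline{V_0\rtimes\Gamma}$ onto $\bar V_0\rtimes\bar\Gamma$. -/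

import Mathlib

open Topology

noncomputable section

/-! ### Hecke pairs and their completions -/

/-- `(N, N₀)` is a Hecke pair: `N₀ ∩ x N₀ x⁻¹` has finite index in `N₀` for all `x ∈ N`. -/
def IsHeckePair {N : Type*} [Group N] (N₀ : Subgroup N) : Prop :=
  ∀ x : N, (N₀ ⊓ N₀.map (MulAut.conj x).toMonoidHom).relIndex N₀ ≠ 0

/-- `(N, N₀)` is reduced: the intersection of all the conjugates `x N₀ x⁻¹` is trivial. -/
def IsReducedPair {N : Type*} [Group N] (N₀ : Subgroup N) : Prop :=
  ⨅ x : N, N₀.map (MulAut.conj x).toMonoidHom = ⊥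

/-- The pair `(M, M₀)` and the homomorphism `ρ : N →* M` form a completion of `(N, N₀)`.
Locally compact groups are Hausdorff. -/
structure IsCompletion {N M : Type*} [Group N] [Group M] [TopologicalSpace M]
    (ρ : N →* M) (N₀ : Subgroup N) (M₀ : Subgroup M) : Prop where
  isTopologicalGroup : IsTopologicalGroup M
  t2Space : T2Space M
  locallyCompactSpace : LocallyCompactSpace M
  isCompact : IsCompact (M₀ : Set M)
  isOpen : IsOpen (M₀ : Set M)
  dense : Dense (Set.range ρ)
  map_le : N₀.map ρ ≤ M₀
  subset_closure : (M₀ : Set M) ⊆ closure (ρ '' (N₀ : Set N))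
  comap_eq : M₀.comap ρ = N₀

/-- The pair `(M, M₀)` and the homomorphism `ρ : N →* M` form the Schlichting completion of
`(N, N₀)`. These properties characterize it uniquely. -/
structure IsSchlichtingCompletion {N M : Type*} [Group N] [Group M] [TopologicalSpace M]
    (ρ : N →* M) (N₀ : Subgroup N) (M₀ : Subgroup M) : Prop where
  isTopologicalGroup : IsTopologicalGroup M
  t2Space : T2Space M
  locallyCompactSpace : LocallyCompactSpace M
  totallyDisconnectedSpace : TotallyDisconnectedSpace M
  isCompact : IsCompact (M₀ : Set M)
  isOpen : IsOpen (M₀ : Set M)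
  reduced : IsReducedPair M₀
  dense : Dense (Set.range ρ)
  comap_eq : M₀.comap ρ = N₀

/-! ### The topological group of homeomorphic automorphisms -/

/-- The group of homeomorphic group automorphisms of `V`. -/
def HA (V : Type*) [Group V] [TopologicalSpace V] : Subgroup (MulAut V) where
  carrier := {f | Continuous f ∧ Continuous f.symm}
  mul_mem' hf hg := ⟨hf.1.comp hg.1, hg.2.comp hf.2⟩
  one_mem' := ⟨continuous_id, continuous_id⟩
  inv_mem' hf := ⟨hf.2, hf.1⟩

/-- The pair of continuous maps `(β, β⁻¹)`. -/
def HA.toPair {V : Type*} [Group V] [TopologicalSpace V] (β : HA V) : C(V, V) × C(V, V) :=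
  (⟨β.1, β.2.1⟩, ⟨β.1.symm, β.2.2⟩)

/-- The topology on `HA V` of uniform convergence on compact sets of `β` and `β⁻¹` (the
Braconnier topology). A neighbourhood basis at the identity is given in `HA.hasBasis_nhds_one`. -/
instance HA.topologicalSpace (V : Type*) [Group V] [TopologicalSpace V] :
    TopologicalSpace (HA V) :=
  TopologicalSpace.induced HA.toPair inferInstance

theorem HA.continuous_toPair {V : Type*} [Group V] [TopologicalSpace V] :
    Continuous (HA.toPair : HA V → C(V, V) × C(V, V)) :=
  continuous_induced_dom

instance HA.isTopologicalGroup (V : Type*) [Group V] [TopologicalSpace V]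
    [LocallyCompactSpace V] : IsTopologicalGroup (HA V) where
  continuous_mul := by
    refine continuous_induced_rng.2 (Continuous.prodMk ?_ ?_)
    · exact Continuous.compCM (continuous_fst.comp (HA.continuous_toPair.comp continuous_fst))
        (continuous_fst.comp (HA.continuous_toPair.comp continuous_snd))
    · exact Continuous.compCM (continuous_snd.comp (HA.continuous_toPair.comp continuous_snd))
        (continuous_snd.comp (HA.continuous_toPair.comp continuous_fst))
  continuous_inv :=
    continuous_induced_rng.2 (continuous_swap.comp HA.continuous_toPair)

/-- The sets `{β | β(u) ∈ U u and β⁻¹(u) ∈ U u for all u ∈ K}`, for compact `K` and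
neighbourhoods `U` of the identity of `V`, form a neighbourhood basis at the identity of `HA V`. -/
theorem HA.hasBasis_nhds_one (V : Type*) [Group V] [TopologicalSpace V] [IsTopologicalGroup V] :
    (𝓝 (1 : HA V)).HasBasis (fun p : Set V × Set V => IsCompact p.1 ∧ p.2 ∈ 𝓝 (1 : V))
      (fun p => {β | ∀ u ∈ p.1, β.1 u * u⁻¹ ∈ p.2 ∧ β.1.symm u * u⁻¹ ∈ p.2}) := by
  let _ : UniformSpace V := IsTopologicalGroup.rightUniformSpace V
  have hU : (uniformity V).HasBasis (fun s : Set V => s ∈ 𝓝 (1 : V))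
      (fun s => (fun p : V × V => p.2 * p.1⁻¹) ⁻¹' s) := (𝓝 (1 : V)).basis_sets.comap _
  have hC := nhds_basis_uniformity' (x := ContinuousMap.id V)
    (hU.compactConvergenceUniformity (α := V))
  have hP := (hC.prod_nhds hC).comap (HA.toPair (V := V))
  have h1 : 𝓝 (1 : HA V) =
      Filter.comap HA.toPair (𝓝 (ContinuousMap.id V, ContinuousMap.id V)) := nhds_induced _ _
  rw [h1]
  refine hP.to_hasBasis ?_ ?_
  · rintro ⟨⟨K, U⟩, ⟨L, S⟩⟩ ⟨⟨hK, hU'⟩, ⟨hL, hS⟩⟩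
    refine ⟨(K ∪ L, U ∩ S), ⟨hK.union hL, Filter.inter_mem hU' hS⟩, fun β hβ => ⟨?_, ?_⟩⟩
    · exact fun u hu => (hβ u (Or.inl hu)).1.1
    · exact fun u hu => (hβ u (Or.inr hu)).2.2
  · rintro ⟨K, U⟩ ⟨hK, hU'⟩
    exact ⟨((K, U), (K, U)), ⟨⟨hK, hU'⟩, ⟨hK, hU'⟩⟩,
      fun β hβ u hu => ⟨hβ.1 u hu, hβ.2 u hu⟩⟩

/-! ### Semidirect products -/

/-- The topology on `V ⋊ G` inherited from the product topology on `V × G`. -/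
instance SemidirectProduct.topologicalSpace {V G : Type*} [Group V] [Group G]
    [TopologicalSpace V] [TopologicalSpace G] (α : G →* MulAut V) :
    TopologicalSpace (V ⋊[α] G) :=
  TopologicalSpace.induced SemidirectProduct.equivProd inferInstance

/-- The subgroup `V₀ ⋊ Γ` of `V ⋊ G`, where `Γ` leaves `V₀` invariant. -/
def semidirectSubgroup {V G : Type*} [Group V] [Group G] (α : G →* MulAut V)
    (V₀ : Subgroup V) (Γ : Subgroup G) (hinv : ∀ γ ∈ Γ, ∀ v ∈ V₀, α γ v ∈ V₀) :
    Subgroup (V ⋊[α] G) where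
  carrier := {x | x.left ∈ V₀ ∧ x.right ∈ Γ}
  mul_mem' hx hy :=
    ⟨V₀.mul_mem hx.1 (hinv _ hx.2 _ hy.1), Γ.mul_mem hx.2 hy.2⟩
  one_mem' := ⟨V₀.one_mem, Γ.one_mem⟩
  inv_mem' hx :=
    ⟨hinv _ (Γ.inv_mem hx.2) _ (V₀.inv_mem hx.1), Γ.inv_mem hx.2⟩

/-! ### The groups `V̄`, `V̄₀`, `Ḡ`, `Γ̄` and the maps between them -/

/-- The closure in `M` of the image of the subgroup `H` of `N`. -/
def closureImage {N M : Type*} [Group N] [Group M] [TopologicalSpace M] [IsTopologicalGroup M]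
    (φ : N →* M) (H : Subgroup N) : Subgroup M :=
  (H.map φ).topologicalClosure

instance closureImage.locallyCompactSpace {N M : Type*} [Group N] [Group M] [TopologicalSpace M]
    [IsTopologicalGroup M] [LocallyCompactSpace M] (φ : N →* M) (H : Subgroup N) :
    LocallyCompactSpace (closureImage φ H) :=
  (Subgroup.isClosed_topologicalClosure (H.map φ)).isClosedEmbedding_subtypeVal.locallyCompactSpace

section

variable {V G W : Type*} [Group V] [Group G] {α : G →* MulAut V}
  [Group W] [TopologicalSpace W] [IsTopologicalGroup W]

/-- `V̄`, the closure of `V` in `W`, where `φ : V ⋊ G →* W`. -/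
abbrev vBar (φ : V ⋊[α] G →* W) : Subgroup W :=
  closureImage φ (SemidirectProduct.inl : V →* V ⋊[α] G).range

/-- `V̄₀`, the closure of `V₀` in `W`, as a subgroup of `V̄`. -/
def vBar₀ (φ : V ⋊[α] G →* W) (V₀ : Subgroup V) : Subgroup (vBar φ) :=
  (closureImage φ (V₀.map SemidirectProduct.inl)).subgroupOf (vBar φ)

theorem closureImage_le_vBar (φ : V ⋊[α] G →* W) (V₀ : Subgroup V) :
    closureImage φ (V₀.map SemidirectProduct.inl) ≤ vBar φ :=
  Subgroup.topologicalClosure_mono (Subgroup.map_mono (Subgroup.map_le_range _ _))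

/-- The map `V →* V̄`. -/
def toVBar (φ : V ⋊[α] G →* W) : V →* vBar φ :=
  (φ.comp SemidirectProduct.inl).codRestrict (vBar φ) fun v =>
    Subgroup.le_topologicalClosure _ ⟨_, ⟨v, rfl⟩, rfl⟩

theorem conj_mem_vBar (φ : V ⋊[α] G →* W) (g : G) {w : W} (hw : w ∈ vBar φ) :
    φ (SemidirectProduct.inr g) * w * (φ (SemidirectProduct.inr g))⁻¹ ∈ vBar φ := by
  refine map_mem_closure (f := fun w => φ (SemidirectProduct.inr g) * w *
    (φ (SemidirectProduct.inr g))⁻¹) (by fun_prop) hw ?_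
  rintro _ ⟨_, ⟨v, rfl⟩, rfl⟩
  exact ⟨_, ⟨α g v, rfl⟩, by rw [SemidirectProduct.inl_aut]; simp⟩

/-- `Ad g`, the automorphism `w ↦ g w g⁻¹` of `V̄`, for `g ∈ G`. -/
def adMulEquiv (φ : V ⋊[α] G →* W) (g : G) : MulAut (vBar φ) where
  toFun w := ⟨φ (SemidirectProduct.inr g) * w * (φ (SemidirectProduct.inr g))⁻¹,
    conj_mem_vBar φ g w.2⟩
  invFun w := ⟨φ (SemidirectProduct.inr g⁻¹) * w * (φ (SemidirectProduct.inr g⁻¹))⁻¹,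
    conj_mem_vBar φ g⁻¹ w.2⟩
  left_inv w := by ext; simp [mul_assoc]
  right_inv w := by ext; simp [mul_assoc]
  map_mul' w w' := by ext; simp [mul_assoc]

/-- The homomorphism `g ↦ Ad g` from `G` into `HA V̄`. -/
def adHom (φ : V ⋊[α] G →* W) : G →* HA (vBar φ) where
  toFun g := ⟨adMulEquiv φ g, by
    constructor
    · exact Continuous.subtype_mk (f := fun w : vBar φ => φ (SemidirectProduct.inr g) * (w : W) *
        (φ (SemidirectProduct.inr g))⁻¹) (by fun_prop) _
    · exact Continuous.subtype_mk (f := fun w : vBar φ => φ (SemidirectProduct.inr g⁻¹) * (w : W) *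
        (φ (SemidirectProduct.inr g⁻¹))⁻¹) (by fun_prop) _⟩
  map_one' := by
    ext w
    simp [adMulEquiv]
  map_mul' g h := by
    ext w
    simp [adMulEquiv, mul_assoc]

variable [LocallyCompactSpace W] {T : Type*} [Group T] [TopologicalSpace T] [IsTopologicalGroup T]

/-- The homomorphism `ρ(g) = (Ad g, ρT g)` from `G` into `HA V̄ × T`. -/
def rhoHom (φ : V ⋊[α] G →* W) (ρT : G →* T) : G →* HA (vBar φ) × T :=
  (adHom φ).prod ρT

/-- `Ḡ`, the closure of `ρ(G)` in `HA V̄ × T`. -/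
abbrev gBar (φ : V ⋊[α] G →* W) (ρT : G →* T) : Subgroup (HA (vBar φ) × T) :=
  closureImage (rhoHom φ ρT) ⊤

/-- `Γ̄`, the closure of `ρ(Γ)` in `HA V̄ × T`, as a subgroup of `Ḡ`. -/
def gammaBar (φ : V ⋊[α] G →* W) (ρT : G →* T) (Γ : Subgroup G) : Subgroup (gBar φ ρT) :=
  (closureImage (rhoHom φ ρT) Γ).subgroupOf (gBar φ ρT)

theorem closureImage_le_gBar (φ : V ⋊[α] G →* W) (ρT : G →* T) (Γ : Subgroup G) :
    closureImage (rhoHom φ ρT) Γ ≤ gBar φ ρT :=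
  Subgroup.topologicalClosure_mono (Subgroup.map_mono le_top)

/-- The homomorphism `ρ` from `G` into `Ḡ`. -/
def toGBar (φ : V ⋊[α] G →* W) (ρT : G →* T) : G →* gBar φ ρT :=
  (rhoHom φ ρT).codRestrict (gBar φ ρT) fun g =>
    Subgroup.le_topologicalClosure _ ⟨g, trivial, rfl⟩

/-- The action of `Ḡ` on `V̄`, through the first coordinate of `HA V̄ × T`. -/
def gBarAction (φ : V ⋊[α] G →* W) (ρT : G →* T) : gBar φ ρT →* MulAut (vBar φ) :=
  ((HA (vBar φ)).subtype.comp (MonoidHom.fst _ _)).comp (gBar φ ρT).subtype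

/-- The map `ι(v, g) = (v, ρ(g))` from `V ⋊ G` into `V̄ ⋊ Ḡ`. -/
def iotaHom (φ : V ⋊[α] G →* W) (ρT : G →* T) :
    V ⋊[α] G →* vBar φ ⋊[gBarAction φ ρT] gBar φ ρT :=
  SemidirectProduct.map (toVBar φ) (toGBar φ ρT) fun g => by
    ext v
    change φ (SemidirectProduct.inl (α g v)) =
      φ (SemidirectProduct.inr g) * φ (SemidirectProduct.inl v) * (φ (SemidirectProduct.inr g))⁻¹
    rw [SemidirectProduct.inl_aut]
    simp

/-- If `Γ` leaves `V₀` invariant then `Γ̄` leaves `V̄₀` invariant. -/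
theorem gBarAction_mem (φ : V ⋊[α] G →* W) (ρT : G →* T) (V₀ : Subgroup V) (Γ : Subgroup G)
    (hinv : ∀ γ ∈ Γ, ∀ v ∈ V₀, α γ v ∈ V₀) :
    ∀ γ ∈ gammaBar φ ρT Γ, ∀ v ∈ vBar₀ φ V₀, gBarAction φ ρT γ v ∈ vBar₀ φ V₀ := by
  rintro ⟨γ, hγ'⟩ hγ ⟨v, hv'⟩ hv
  have hcl : IsClosed (closureImage φ (V₀.map SemidirectProduct.inl) : Set W) :=
    Subgroup.isClosed_topologicalClosure _
  have hpair : Continuous fun x : HA (vBar φ) × T => (HA.toPair x.1).1 :=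
    continuous_fst.comp (HA.continuous_toPair.comp continuous_fst)
  have hev : Continuous fun x : HA (vBar φ) × T => (((HA.toPair x.1).1 ⟨v, hv'⟩ : vBar φ) : W) :=
    continuous_subtype_val.comp
      ((ContinuousEvalConst.continuous_eval_const (⟨v, hv'⟩ : vBar φ)).comp hpair)
  change ((γ.1.1 ⟨v, hv'⟩ : vBar φ) : W) ∈ closureImage φ (V₀.map SemidirectProduct.inl)
  refine closure_minimal (s := ((Γ.map (rhoHom φ ρT) : Subgroup _) : Set (HA (vBar φ) × T)))
    ?_ (hcl.preimage hev) hγ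
  rintro _ ⟨g, hg, rfl⟩
  change φ (SemidirectProduct.inr g) * v * (φ (SemidirectProduct.inr g))⁻¹ ∈
    closureImage φ (V₀.map SemidirectProduct.inl)
  refine map_mem_closure (f := fun w => φ (SemidirectProduct.inr g) * w *
    (φ (SemidirectProduct.inr g))⁻¹) (by fun_prop) hv ?_
  rintro _ ⟨_, ⟨u, hu, rfl⟩, rfl⟩
  exact ⟨_, ⟨α g u, hinv g hg u hu, rfl⟩, by rw [SemidirectProduct.inl_aut]; simp⟩

/-- The subgroup `V̄₀ ⋊ Γ̄` of `V̄ ⋊ Ḡ`. -/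
def completedSubgroup (φ : V ⋊[α] G →* W) (ρT : G →* T) (V₀ : Subgroup V) (Γ : Subgroup G)
    (hinv : ∀ γ ∈ Γ, ∀ v ∈ V₀, α γ v ∈ V₀) :
    Subgroup (vBar φ ⋊[gBarAction φ ρT] gBar φ ρT) :=
  semidirectSubgroup (gBarAction φ ρT) (vBar₀ φ V₀) (gammaBar φ ρT Γ)
    (gBarAction_mem φ ρT V₀ Γ hinv)

end

end

noncomputable section

/-! ### Subgroups with dense and open conditions -/

/-! Everything rests on the compactness of `Γ̄`. It is a closed subset of the product of the closure
of `Ad Γ` with `T₀`, so it suffices that `Ad Γ` is relatively compact in `HA V̄`. This is an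
Arzelà–Ascoli argument (`HA.isCompact_closure`), and the Hecke condition on `V₀ ⋊ Γ` supplies both
inputs. Finite intersections of conjugates of `W₀` form a neighbourhood basis at `1`, and `V₀ ⋊ Γ`
normalizes `W₀` and moves each coset through a finite orbit: this gives equicontinuity
(`exists_nhds_conj_mem`). Likewise `Γ` moves a coset `v V₀` through finitely many cosets, so its
orbits on `V̄` are relatively compact (`exists_isCompact_conj_mem`). The remaining completion
properties are checked in each coordinate.

In (ii), let `x` lie in all conjugates of `V̄₀ ⋊ Γ̄`. Conjugating by `G` kills its `T`-component,
because `(T, T₀)` is reduced, and its `V̄`-component, because the condition on `V` makes conjugation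
by `G` separate the points of `W`. Conjugating by `u ∈ V̄` then shows that the automorphism part
fixes `u`. Uniqueness of Schlichting completions gives the isomorphism: the closure of the set of
pairs `(θ n, ι n)` is its graph. -/

theorem IsReducedPair.eq_one {M : Type*} [Group M] {M₀ : Subgroup M} (h : IsReducedPair M₀) {w : M}
    (hw : ∀ x : M, x⁻¹ * w * x ∈ M₀) : w = 1 := by
  have : w ∈ ⨅ x : M, M₀.map (MulAut.conj x).toMonoidHom := by
    rw [Subgroup.mem_iInf]
    exact fun x => ⟨_, hw x, by simp [mul_assoc]⟩
  rwa [h, Subgroup.mem_bot] at this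

theorem isReducedPair_of_forall {M : Type*} [Group M] {M₀ : Subgroup M}
    (h : ∀ w : M, (∀ x : M, x⁻¹ * w * x ∈ M₀) → w = 1) : IsReducedPair M₀ := by
  refine (Subgroup.eq_bot_iff_forall _).2 fun w hw => h w fun x => ?_
  obtain ⟨u, hu, rfl⟩ := Subgroup.mem_iInf.1 hw x
  simpa [mul_assoc] using hu

theorem Dense.exists_inv_mul_mem {N M : Type*} [Group M] [TopologicalSpace M] [IsTopologicalGroup M]
    {φ : N → M} {M₀ : Subgroup M} (hd : Dense (Set.range φ)) (ho : IsOpen (M₀ : Set M)) (x : M) :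
    ∃ n, x⁻¹ * φ n ∈ M₀ := by
  have ho' : IsOpen ((fun y => x⁻¹ * y) ⁻¹' (M₀ : Set M)) := ho.preimage (by fun_prop)
  obtain ⟨_, hy, n, rfl⟩ := hd.inter_open_nonempty _ ho' ⟨x, by simp [M₀.one_mem]⟩
  exact ⟨n, hy⟩

theorem Dense.subset_closure_image_preimage {N M : Type*} [TopologicalSpace M] {φ : N → M}
    {S : Set M} (hd : Dense (Set.range φ)) (ho : IsOpen S) :
    S ⊆ closure (φ '' (φ ⁻¹' S)) := by
  rw [Set.image_preimage_eq_inter_range]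
  exact hd.open_subset_closure_inter ho

/-- For a dense image it suffices to test conjugation by elements of the image. -/
theorem Dense.conj_mem_of_forall {N M : Type*} [Group N] [Group M] [TopologicalSpace M]
    [IsTopologicalGroup M] {φ : N →* M} {M₀ : Subgroup M} (hd : Dense (Set.range φ))
    (ho : IsOpen (M₀ : Set M)) {w : M} (hw : ∀ n, (φ n)⁻¹ * w * φ n ∈ M₀) (x : M) :
    x⁻¹ * w * x ∈ M₀ := by
  obtain ⟨n, hn⟩ := hd.exists_inv_mul_mem ho x
  have := M₀.mul_mem (M₀.mul_mem hn (hw n)) (M₀.inv_mem hn)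
  simpa [mul_assoc] using this

theorem IsReducedPair.eq_one_of_dense {N M : Type*} [Group N] [Group M] [TopologicalSpace M]
    [IsTopologicalGroup M] {φ : N →* M} {M₀ : Subgroup M} (h : IsReducedPair M₀)
    (hd : Dense (Set.range φ)) (ho : IsOpen (M₀ : Set M)) {w : M}
    (hw : ∀ n, (φ n)⁻¹ * w * φ n ∈ M₀) : w = 1 :=
  h.eq_one (hd.conj_mem_of_forall ho hw)

theorem TotallyDisconnectedSpace.of_injective {X Y : Type*} [TopologicalSpace X]
    [TopologicalSpace Y] [TotallyDisconnectedSpace Y] {f : X → Y} (hf : Continuous f)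
    (hi : Function.Injective f) : TotallyDisconnectedSpace X :=
  ⟨isTotallyDisconnected_of_image hf.continuousOn hi
    (isTotallyDisconnected_of_totallyDisconnectedSpace _)⟩

/-! ### Uniqueness of Schlichting completions -/

section Uniqueness

variable {N P M : Type*} [Group N] [Group P] [Group M] [TopologicalSpace P] [TopologicalSpace M]

theorem IsSchlichtingCompletion.subset_closure {N₀ : Subgroup N} {P₀ : Subgroup P} {θ : N →* P}
    (h : IsSchlichtingCompletion θ N₀ P₀) : (P₀ : Set P) ⊆ closure (θ '' (N₀ : Set N)) := by
  have := h.dense.subset_closure_image_preimage h.isOpen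
  rwa [← Subgroup.coe_comap, h.comap_eq] at this

variable [IsTopologicalGroup P] [IsTopologicalGroup M]

/-- The closure in `P × M` of the graph of the correspondence `θ n ↔ ι n`. -/
def closureGraph (θ : N →* P) (ι : N →* M) : Subgroup (P × M) :=
  (θ.prod ι).range.topologicalClosure

theorem closureGraph.mem_image (θ : N →* P) (ι : N →* M) (n : N) :
    (θ n, ι n) ∈ closureGraph θ ι :=
  Subgroup.le_topologicalClosure _ ⟨n, rfl⟩

theorem closureGraph.isClosed (θ : N →* P) (ι : N →* M) :
    IsClosed (closureGraph θ ι : Set (P × M)) :=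
  Subgroup.isClosed_topologicalClosure _

theorem closureGraph.swap {θ : N →* P} {ι : N →* M} {p : P} {m : M}
    (h : (p, m) ∈ closureGraph θ ι) : (m, p) ∈ closureGraph ι θ := by
  refine map_mem_closure (f := Prod.swap) continuous_swap h ?_
  rintro _ ⟨n, rfl⟩
  exact ⟨n, rfl⟩

variable {N₀ : Subgroup N} {P₀ : Subgroup P} {M₀ : Subgroup M} {θ : N →* P} {ι : N →* M}

/-- Since `P₀` is open, `(p, m)` is a limit of pairs `(θ n, ι n)` with `θ n ∈ P₀`. Then `n ∈ N₀`, so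
`ι n` stays in the closed set `M₀`. -/
theorem closureGraph.mem_of_mem (hP : IsSchlichtingCompletion θ N₀ P₀)
    (hM : IsSchlichtingCompletion ι N₀ M₀) {p : P} {m : M} (h : (p, m) ∈ closureGraph θ ι)
    (hp : p ∈ P₀) : m ∈ M₀ := by
  have ho : IsOpen (Prod.fst ⁻¹' (P₀ : Set P) : Set (P × M)) := hP.isOpen.preimage continuous_fst
  have h1 := ho.closure_inter (s := ((θ.prod ι).range : Set (P × M))) ⟨h, hp⟩
  have hc : IsClosed (Prod.snd ⁻¹' (M₀ : Set M) : Set (P × M)) :=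
    (M₀.isClosed_of_isOpen hM.isOpen).preimage continuous_snd
  refine closure_minimal ?_ hc h1
  rintro _ ⟨⟨n, rfl⟩, hn⟩
  have hn' : n ∈ P₀.comap θ := hn
  rw [hP.comap_eq, ← hM.comap_eq] at hn'
  exact hn'

/-- The graph is a subgroup, so conjugating `(1, m)` by `(θ n, ι n)` keeps the first coordinate `1`.
Hence all these conjugates of `m` lie in `M₀`, and reducedness applies. -/
theorem closureGraph.eq_one (hP : IsSchlichtingCompletion θ N₀ P₀)
    (hM : IsSchlichtingCompletion ι N₀ M₀) {m : M} (h : (1, m) ∈ closureGraph θ ι) : m = 1 := by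
  refine hM.reduced.eq_one_of_dense hM.dense hM.isOpen fun n =>
    closureGraph.mem_of_mem hP hM (p := (θ n)⁻¹ * 1 * θ n) ?_ (by simp)
  have hn := closureGraph.mem_image θ ι n
  exact mul_mem (mul_mem (inv_mem hn) h) hn

/-- The part of the graph in the compact set `P₀ × M₀` has a closed projection to `P`, and this
contains the dense subset `θ(N₀)` of `P₀`. -/
theorem closureGraph.exists_of_mem (hP : IsSchlichtingCompletion θ N₀ P₀)
    (hM : IsSchlichtingCompletion ι N₀ M₀) {p : P} (hp : p ∈ P₀) :
    ∃ m, (p, m) ∈ closureGraph θ ι := by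
  have := hP.t2Space
  have hK : IsCompact ((closureGraph θ ι : Set (P × M)) ∩ (P₀ : Set P) ×ˢ (M₀ : Set M)) :=
    (hP.isCompact.prod hM.isCompact).inter_left (closureGraph.isClosed θ ι)
  have hcl : (P₀ : Set P) ⊆ Prod.fst '' ((closureGraph θ ι : Set (P × M)) ∩
      (P₀ : Set P) ×ˢ (M₀ : Set M)) := by
    refine hP.subset_closure.trans (closure_minimal ?_ (hK.image continuous_fst).isClosed)
    rintro _ ⟨n, hn, rfl⟩
    refine ⟨(θ n, ι n), ⟨closureGraph.mem_image θ ι n, ?_, ?_⟩, rfl⟩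
    · change n ∈ P₀.comap θ
      rwa [hP.comap_eq]
    · change n ∈ M₀.comap ι
      rwa [hM.comap_eq]
  obtain ⟨⟨_, m⟩, ⟨h, -⟩, rfl⟩ := hcl hp
  exact ⟨m, h⟩

theorem closureGraph.exists (hP : IsSchlichtingCompletion θ N₀ P₀)
    (hM : IsSchlichtingCompletion ι N₀ M₀) (p : P) : ∃ m, (p, m) ∈ closureGraph θ ι := by
  obtain ⟨n, hn⟩ := hP.dense.exists_inv_mul_mem hP.isOpen p
  obtain ⟨m, hm⟩ := closureGraph.exists_of_mem hP hM hn
  have := mul_mem (closureGraph.mem_image θ ι n) (inv_mem hm)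
  exact ⟨ι n * m⁻¹, by simpa [Prod.inv_mk, Prod.mk_mul_mk] using this⟩

theorem closureGraph.unique (hP : IsSchlichtingCompletion θ N₀ P₀)
    (hM : IsSchlichtingCompletion ι N₀ M₀) {p : P} {m m' : M} (h : (p, m) ∈ closureGraph θ ι)
    (h' : (p, m') ∈ closureGraph θ ι) : m = m' := by
  have := mul_mem (inv_mem h) h'
  rw [Prod.inv_mk, Prod.mk_mul_mk, inv_mul_cancel] at this
  exact inv_mul_eq_one.1 (closureGraph.eq_one hP hM this)

/-- The homomorphism between Schlichting completions whose graph is `closureGraph`. -/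
def completionHom (hP : IsSchlichtingCompletion θ N₀ P₀)
    (hM : IsSchlichtingCompletion ι N₀ M₀) : P →* M :=
  MonoidHom.mk' (fun p => (closureGraph.exists hP hM p).choose) fun p q =>
    closureGraph.unique hP hM (closureGraph.exists hP hM (p * q)).choose_spec
      (mul_mem (closureGraph.exists hP hM p).choose_spec
        (closureGraph.exists hP hM q).choose_spec)

theorem completionHom_graph (hP : IsSchlichtingCompletion θ N₀ P₀)
    (hM : IsSchlichtingCompletion ι N₀ M₀) (p : P) :
    (p, completionHom hP hM p) ∈ closureGraph θ ι :=
  (closureGraph.exists hP hM p).choose_spec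

theorem completionHom_eq_iff (hP : IsSchlichtingCompletion θ N₀ P₀)
    (hM : IsSchlichtingCompletion ι N₀ M₀) {p : P} {m : M} :
    completionHom hP hM p = m ↔ (p, m) ∈ closureGraph θ ι :=
  ⟨fun h => h ▸ completionHom_graph hP hM p,
    fun h => closureGraph.unique hP hM (completionHom_graph hP hM p) h⟩

theorem continuous_completionHom (hP : IsSchlichtingCompletion θ N₀ P₀)
    (hM : IsSchlichtingCompletion ι N₀ M₀) : Continuous (completionHom hP hM) := by
  have := hP.t2Space
  refine continuous_of_continuousAt_one _ ?_
  rw [ContinuousAt, map_one, Filter.tendsto_def]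
  intro U hU
  obtain ⟨O, hOU, hO, h1⟩ := mem_nhds_iff.1 hU
  -- A closed graph argument: the points of `P₀` with a partner in `M₀` outside `O` form a compact
  -- set, which misses `1`.
  have hK : IsCompact ((closureGraph θ ι : Set (P × M)) ∩
      (P₀ : Set P) ×ˢ ((M₀ : Set M) ∩ Oᶜ)) :=
    (hP.isCompact.prod (hM.isCompact.inter_right hO.isClosed_compl)).inter_left
      (closureGraph.isClosed θ ι)
  have hC := (hK.image continuous_fst).isClosed
  have h2 : (Prod.fst '' ((closureGraph θ ι : Set (P × M)) ∩
      (P₀ : Set P) ×ˢ ((M₀ : Set M) ∩ Oᶜ)))ᶜ ∈ 𝓝 (1 : P) := by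
    refine hC.isOpen_compl.mem_nhds ?_
    rintro ⟨⟨_, m⟩, ⟨h, -, -, hm⟩, rfl⟩
    exact hm (closureGraph.eq_one hP hM h ▸ h1)
  filter_upwards [h2, hP.isOpen.mem_nhds P₀.one_mem] with p hp hp0
  by_contra hpU
  have hg := completionHom_graph hP hM p
  exact hp ⟨(p, completionHom hP hM p),
    ⟨hg, hp0, closureGraph.mem_of_mem hP hM hg hp0, fun h => hpU (hOU h)⟩, rfl⟩

/-- The isomorphism between two Schlichting completions of a pair. -/
def completionEquiv (hP : IsSchlichtingCompletion θ N₀ P₀)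
    (hM : IsSchlichtingCompletion ι N₀ M₀) : P ≃ₜ* M where
  toFun := completionHom hP hM
  invFun := completionHom hM hP
  left_inv p := (completionHom_eq_iff hM hP).2 (closureGraph.swap (completionHom_graph hP hM p))
  right_inv m := (completionHom_eq_iff hP hM).2 (closureGraph.swap (completionHom_graph hM hP m))
  map_mul' := map_mul _
  continuous_toFun := continuous_completionHom hP hM
  continuous_invFun := continuous_completionHom hM hP

theorem IsSchlichtingCompletion.exists_continuousMulEquiv (hP : IsSchlichtingCompletion θ N₀ P₀)
    (hM : IsSchlichtingCompletion ι N₀ M₀) :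
    ∃ Φ : P ≃ₜ* M, (∀ x, Φ (θ x) = ι x) ∧ P₀.map Φ.toMulEquiv.toMonoidHom = M₀ := by
  refine ⟨completionEquiv hP hM,
    fun x => (completionHom_eq_iff hP hM).2 (closureGraph.mem_image θ ι x), ?_⟩
  ext m
  constructor
  · rintro ⟨p, hp, rfl⟩
    exact closureGraph.mem_of_mem hP hM (completionHom_graph hP hM p) hp
  · intro hm
    exact ⟨completionHom hM hP m, closureGraph.mem_of_mem hM hP (completionHom_graph hM hP m) hm,
      (completionHom_eq_iff hP hM).2 (closureGraph.swap (completionHom_graph hM hP m))⟩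

end Uniqueness

/-! ### Topological semidirect products -/

namespace SemidirectProduct

variable {V G : Type*} [Group V] [Group G] [TopologicalSpace V] [TopologicalSpace G]
  {α : G →* MulAut V}

/-- The homeomorphism of `V ⋊ G` with `V × G`. -/
def homeomorphProd : V ⋊[α] G ≃ₜ V × G :=
  equivProd.toHomeomorphOfIsInducing ⟨rfl⟩

theorem continuous_left : Continuous (left : V ⋊[α] G → V) :=
  continuous_fst.comp homeomorphProd.continuous

theorem continuous_right : Continuous (right : V ⋊[α] G → G) :=
  continuous_snd.comp homeomorphProd.continuous

theorem continuous_mk {X : Type*} [TopologicalSpace X] {f : X → V} {g : X → G}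
    (hf : Continuous f) (hg : Continuous g) :
    Continuous fun x => (⟨f x, g x⟩ : V ⋊[α] G) :=
  homeomorphProd.symm.continuous.comp (hf.prodMk hg)

theorem isTopologicalGroup_of_continuous [IsTopologicalGroup V] [IsTopologicalGroup G]
    (hα : Continuous fun p : G × V => α p.1 p.2) : IsTopologicalGroup (V ⋊[α] G) where
  continuous_mul := by
    refine continuous_mk ?_ ?_
    · exact (continuous_left.comp continuous_fst).mul (hα.comp
        ((continuous_right.comp continuous_fst).prodMk (continuous_left.comp continuous_snd)))
    · exact (continuous_right.comp continuous_fst).mul (continuous_right.comp continuous_snd)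
  continuous_inv := by
    refine continuous_mk ?_ ?_
    · exact hα.comp (continuous_right.inv.prodMk continuous_left.inv)
    · exact continuous_right.inv

instance [T2Space V] [T2Space G] : T2Space (V ⋊[α] G) :=
  homeomorphProd.symm.t2Space

end SemidirectProduct

/-! ### Compactness in `HA V` -/

namespace HA

variable {V : Type*} [Group V] [TopologicalSpace V]

theorem toPair_injective : Function.Injective (toPair : HA V → C(V, V) × C(V, V)) := by
  intro β β' h
  refine Subtype.ext (MulEquiv.ext fun v => ?_)
  exact DFunLike.congr_fun (congrArg Prod.fst h) v

instance [T2Space V] : T2Space (HA V) :=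
  T2Space.of_injective_continuous toPair_injective continuous_toPair

theorem continuous_eval [LocallyCompactSpace V] :
    Continuous fun p : HA V × V => p.1.1 p.2 :=
  ContinuousEval.continuous_eval.comp
    ((continuous_fst.comp (continuous_toPair.comp continuous_fst)).prodMk continuous_snd)

/-- Recording the inverse along with `β` makes invertibility a closed condition. Joint continuity of
evaluation, from local compactness, makes `p.2 (p.1 v)` continuous in `p`. -/
theorem isClosedEmbedding_toPair [IsTopologicalGroup V] [LocallyCompactSpace V] [T2Space V] :
    IsClosedEmbedding (toPair : HA V → C(V, V) × C(V, V)) := by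
  refine ⟨⟨⟨rfl⟩, toPair_injective⟩, ?_⟩
  have key : Set.range (toPair : HA V → C(V, V) × C(V, V)) =
      (⋂ u : V, ⋂ v : V, {p | p.1 (u * v) = p.1 u * p.1 v}) ∩
        (⋂ v : V, {p | p.2 (p.1 v) = v}) ∩ ⋂ v : V, {p | p.1 (p.2 v) = v} := by
    ext ⟨f, g⟩
    simp only [Set.mem_range, Set.mem_inter_iff, Set.mem_iInter, Set.mem_ofPred_eq]
    constructor
    · rintro ⟨β, hβ⟩
      obtain ⟨rfl, rfl⟩ := Prod.ext_iff.1 hβ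
      exact ⟨⟨fun u v => map_mul β.1 u v, fun v => β.1.symm_apply_apply v⟩,
        fun v => β.1.apply_symm_apply v⟩
    · rintro ⟨⟨hm, hl⟩, hr⟩
      exact ⟨⟨⟨⟨f, g, hl, hr⟩, hm⟩, f.continuous, g.continuous⟩, rfl⟩
  rw [key]
  have h1 (v : V) : Continuous fun p : C(V, V) × C(V, V) => p.1 v := by fun_prop
  have h2 (v : V) : Continuous fun p : C(V, V) × C(V, V) => p.2 v := by fun_prop
  have h3 (v : V) : Continuous fun p : C(V, V) × C(V, V) => p.2 (p.1 v) :=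
    ContinuousEval.continuous_eval.comp (continuous_snd.prodMk (h1 v))
  have h4 (v : V) : Continuous fun p : C(V, V) × C(V, V) => p.1 (p.2 v) :=
    ContinuousEval.continuous_eval.comp (continuous_fst.prodMk (h2 v))
  exact ((isClosed_iInter fun u => isClosed_iInter fun v =>
    isClosed_eq (h1 _) ((h1 u).mul (h1 v))).inter
      (isClosed_iInter fun v => isClosed_eq (h3 v) continuous_const)).inter
        (isClosed_iInter fun v => isClosed_eq (h4 v) continuous_const)

/-- A pointwise relatively compact, equicontinuous set of continuous endomorphisms
of a topological group is contained in a compact set. -/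
theorem exists_isCompact_of_equicontinuous [IsTopologicalGroup V] [T2Space V]
    {S : Set C(V, V)} (hmul : ∀ f ∈ S, ∀ u v, f (u * v) = f u * f v)
    (hpt : ∀ v, ∃ K, IsCompact K ∧ ∀ f ∈ S, f v ∈ K)
    (heq : ∀ U ∈ 𝓝 (1 : V), ∃ O ∈ 𝓝 (1 : V), ∀ f ∈ S, ∀ u ∈ O, f u ∈ U) :
    ∃ C, IsCompact C ∧ S ⊆ C := by
  choose K hK hSK using hpt
  choose! O hO hSO using heq
  -- By Tychonoff, `D` is compact for pointwise convergence. Restricting to closed `U` makes the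
  -- equicontinuity conditions closed; closed neighbourhoods form a basis, so nothing is lost.
  set D : Set (V → V) := Set.univ.pi K ∩ ((⋂ u : V, ⋂ v : V, {f | f (u * v) = f u * f v}) ∩
    ⋂ U : {U : Set V // U ∈ 𝓝 1 ∧ IsClosed U}, ⋂ u : O U.1, {f : V → V | f u.1 ∈ U.1}) with hD
  have hDc : IsCompact D := by
    refine (isCompact_univ_pi hK).inter_right (IsClosed.inter ?_ ?_)
    · exact isClosed_iInter fun u => isClosed_iInter fun v =>
        isClosed_eq (_root_.continuous_apply _) ((_root_.continuous_apply u).mul (_root_.continuous_apply v))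
    · exact isClosed_iInter fun U => isClosed_iInter fun u =>
        U.2.2.preimage (_root_.continuous_apply u.1)
  have hDeq : ∀ U ∈ 𝓝 (1 : V), ∃ O ∈ 𝓝 (1 : V), ∀ f ∈ D, ∀ u ∈ O, f u ∈ U := by
    intro U hU
    obtain ⟨C, ⟨hC, hCc⟩, hCU⟩ := (closed_nhds_basis (1 : V)).mem_iff.1 hU
    exact ⟨O C, hO C hC, fun f hf u hu =>
      hCU (Set.mem_iInter.1 (Set.mem_iInter.1 hf.2.2 ⟨C, hC, hCc⟩) ⟨u, hu⟩)⟩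
  have hDmul : ∀ f ∈ D, ∀ u v, f (u * v) = f u * f v := fun f hf u v =>
    Set.mem_iInter.1 (Set.mem_iInter.1 hf.2.1 u) v
  have hDcont : ∀ f ∈ D, Continuous f := by
    intro f hf
    refine continuous_of_continuousAt_one (MonoidHom.mk' f (hDmul f hf)) ?_
    rw [ContinuousAt, map_one, Filter.tendsto_def]
    intro U hU
    obtain ⟨O', hO', h⟩ := hDeq U hU
    exact Filter.mem_of_superset hO' fun u hu => h f hf u hu
  refine ⟨{f | ⇑f ∈ D}, ?_, fun f hf => ⟨fun v _ => hSK v f hf, ?_, ?_⟩⟩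
  · let : UniformSpace V := IsTopologicalGroup.rightUniformSpace V
    refine ArzelaAscoli.isCompact_of_equicontinuous _ ?_ ?_
    · convert hDc
      ext f
      exact ⟨fun ⟨g, hg, h⟩ => h ▸ hg, fun h => ⟨⟨f, hDcont f h⟩, h, rfl⟩⟩
    · intro x s hs
      obtain ⟨U, hU, hUs⟩ := Filter.mem_comap.1 hs
      obtain ⟨O', hO', h⟩ := hDeq U hU
      have ht : Filter.Tendsto (fun y => y * x⁻¹) (𝓝 x) (𝓝 1) := by
        have : Continuous fun y : V => y * x⁻¹ := by fun_prop
        simpa using this.tendsto x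
      filter_upwards [ht hO'] with y hy f
      refine hUs ?_
      -- For the right uniformity, `f y * (f x)⁻¹ = f (y * x⁻¹)` reduces equicontinuity at `x` to
      -- equicontinuity at `1`.
      have hfm := hDmul f.1 f.2 (y * x⁻¹) x
      rw [inv_mul_cancel_right] at hfm
      change f.1 y * (f.1 x)⁻¹ ∈ U
      rw [hfm, mul_inv_cancel_right]
      exact h _ f.2 _ hy
  · exact Set.mem_iInter.2 fun u => Set.mem_iInter.2 fun v => hmul f hf u v
  · exact Set.mem_iInter.2 fun U => Set.mem_iInter.2 fun u => hSO U.1 U.2.1 f hf u.1 u.2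

/-- As `S` is stable under inversion, one compact set `C` contains both coordinates of `toPair` on
`S`. -/
theorem isCompact_closure [IsTopologicalGroup V] [LocallyCompactSpace V] [T2Space V]
    {S : Set (HA V)} (hinv : ∀ β ∈ S, β⁻¹ ∈ S)
    (hpt : ∀ v, ∃ K, IsCompact K ∧ ∀ β ∈ S, β.1 v ∈ K)
    (heq : ∀ U ∈ 𝓝 (1 : V), ∃ O ∈ 𝓝 (1 : V), ∀ β ∈ S, ∀ u ∈ O, β.1 u ∈ U) :
    IsCompact (closure S) := by
  obtain ⟨C, hC, hSC⟩ := exists_isCompact_of_equicontinuous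
    (S := (fun β : HA V => (toPair β).1) '' S)
    (by rintro _ ⟨β, -, rfl⟩ u v; exact map_mul β.1 u v)
    (fun v => by
      obtain ⟨K, hK, h⟩ := hpt v
      exact ⟨K, hK, by rintro _ ⟨β, hβ, rfl⟩; exact h β hβ⟩)
    (fun U hU => by
      obtain ⟨O, hO, h⟩ := heq U hU
      exact ⟨O, hO, by rintro _ ⟨β, hβ, rfl⟩; exact h β hβ⟩)
  refine (isClosedEmbedding_toPair.isCompact_preimage (hC.prod hC)).closure_of_subset ?_
  exact fun β hβ => ⟨hSC ⟨β, hβ, rfl⟩, hSC ⟨β⁻¹, hinv β hβ, rfl⟩⟩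

instance [TotallyDisconnectedSpace V] : TotallyDisconnectedSpace (HA V) :=
  TotallyDisconnectedSpace.of_injective (f := fun (β : HA V) v => (toPair β).1 v)
    (continuous_pi fun v => (ContinuousEvalConst.continuous_eval_const v).comp
      (continuous_fst.comp continuous_toPair))
    fun _ _ h => Subtype.ext (MulEquiv.ext fun v => congrFun h v)

end HA

/-! ### Finiteness from the Hecke condition and from reducedness -/

/-- In a Hecke pair, `N₀` has finitely many orbits of left translates of each coset `x N₀`. -/
theorem IsHeckePair.exists_finset {N : Type*} [Group N] {N₀ : Subgroup N} (h : IsHeckePair N₀)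
    (x : N) : ∃ s : Finset N, ∀ n ∈ N₀, ∃ y ∈ s, (y * x)⁻¹ * (n * x) ∈ N₀ := by
  classical
  set H := N₀ ⊓ N₀.map (MulAut.conj x).toMonoidHom with hH
  have hfin : (H.subgroupOf N₀).FiniteIndex := ⟨h x⟩
  have := Fintype.ofFinite (N₀ ⧸ H.subgroupOf N₀)
  -- Representatives of `N₀` modulo `N₀ ∩ x N₀ x⁻¹`: if `n = y * (x * k * x⁻¹)`, then `(y * x)⁻¹ *
  -- (n * x) = k`.
  refine ⟨Finset.univ.image fun q : N₀ ⧸ H.subgroupOf N₀ => (q.out : N), fun n hn => ?_⟩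
  refine ⟨((QuotientGroup.mk ⟨n, hn⟩ : N₀ ⧸ H.subgroupOf N₀).out : N),
    Finset.mem_image_of_mem _ (Finset.mem_univ _), ?_⟩
  have h1 := QuotientGroup.eq.1
    (QuotientGroup.out_eq' (QuotientGroup.mk ⟨n, hn⟩ : N₀ ⧸ H.subgroupOf N₀))
  rw [Subgroup.mem_subgroupOf] at h1
  obtain ⟨k, hk, hkx⟩ := h1.2
  have hkx' : x * k * x⁻¹ = _ := hkx
  have hk' : k = x⁻¹ * (x * k * x⁻¹) * x := by simp [mul_assoc]
  rw [hkx'] at hk'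
  rw [hk'] at hk
  simpa [mul_assoc] using hk

/-- The closed conjugates of `M₀` by the dense image meet only in `1`, so by compactness finitely
many already miss the part of `M₀` outside the interior of `U`. -/
theorem IsSchlichtingCompletion.exists_finset_subset {N M : Type*} [Group N] [Group M]
    [TopologicalSpace M] {φ : N →* M} {N₀ : Subgroup N} {M₀ : Subgroup M}
    (h : IsSchlichtingCompletion φ N₀ M₀) {U : Set M} (hU : U ∈ 𝓝 (1 : M)) :
    ∃ F : Finset N, ∀ w, (∀ n ∈ F, (φ n)⁻¹ * w * φ n ∈ M₀) → w ∈ U := by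
  classical
  have := h.isTopologicalGroup
  have hc (n : N) : IsClosed {w | (φ n)⁻¹ * w * φ n ∈ M₀} :=
    (M₀.isClosed_of_isOpen h.isOpen).preimage (f := fun w => (φ n)⁻¹ * w * φ n) (by fun_prop)
  obtain ⟨F, hF⟩ := (h.isCompact.inter_right (isOpen_interior (s := U)).isClosed_compl
    ).elim_finite_subfamily_closed _ hc (by
      refine Set.eq_empty_of_forall_notMem fun w hw => hw.1.2 ?_
      rw [h.reduced.eq_one_of_dense h.dense h.isOpen fun n => Set.mem_iInter.1 hw.2 n]
      exact mem_interior_iff_mem_nhds.2 hU)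
  -- The element `1` forces `w` into `M₀`, where compactness was used.
  refine ⟨insert 1 F, fun w hw => ?_⟩
  by_contra hwU
  refine Set.eq_empty_iff_forall_notMem.1 hF w
    ⟨⟨?_, fun hi => hwU (interior_subset hi)⟩, ?_⟩
  · simpa using hw 1 (Finset.mem_insert_self _ _)
  · exact Set.mem_iInter₂.2 fun n hn => hw n (Finset.mem_insert_of_mem hn)

theorem inl_mem_iff {V G W : Type*} [Group V] [Group G] {α : G →* MulAut V} [Group W]
    [TopologicalSpace W] {V₀ : Subgroup V} {W₀ : Subgroup W} {φ : V ⋊[α] G →* W}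
    (hφ : IsSchlichtingCompletion φ (V₀.map SemidirectProduct.inl) W₀) (v : V) :
    φ (SemidirectProduct.inl v) ∈ W₀ ↔ v ∈ V₀ := by
  rw [← Subgroup.mem_comap, hφ.comap_eq]
  exact Subgroup.mem_map_iff_mem SemidirectProduct.inl_injective

/-! ### The pair `(V̄, V̄₀)` and the action of `Γ` on it -/

section

variable {V G W : Type*} [Group V] [Group G] {α : G →* MulAut V}
  [Group W] [TopologicalSpace W] [IsTopologicalGroup W]
  {V₀ : Subgroup V} {W₀ : Subgroup W} {φ : V ⋊[α] G →* W}

theorem closureImage_inl_eq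
    (hφ : IsSchlichtingCompletion φ (V₀.map SemidirectProduct.inl) W₀) :
    closureImage φ (V₀.map SemidirectProduct.inl) = W₀ := by
  refine le_antisymm (Subgroup.topologicalClosure_minimal _ ?_
    (W₀.isClosed_of_isOpen hφ.isOpen)) hφ.subset_closure
  rw [Subgroup.map_le_iff_le_comap, hφ.comap_eq]

theorem mem_vBar₀_iff (hφ : IsSchlichtingCompletion φ (V₀.map SemidirectProduct.inl) W₀)
    (w : vBar φ) : w ∈ vBar₀ φ V₀ ↔ (w : W) ∈ W₀ := by
  rw [vBar₀, Subgroup.mem_subgroupOf, closureImage_inl_eq hφ]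

theorem isCompact_vBar₀ (hφ : IsSchlichtingCompletion φ (V₀.map SemidirectProduct.inl) W₀) :
    IsCompact (vBar₀ φ V₀ : Set (vBar φ)) := by
  have he : IsClosedEmbedding (Subtype.val : vBar φ → W) :=
    (Subgroup.isClosed_topologicalClosure _).isClosedEmbedding_subtypeVal
  convert he.isCompact_preimage hφ.isCompact
  ext w
  exact mem_vBar₀_iff hφ w

theorem isOpen_vBar₀ (hφ : IsSchlichtingCompletion φ (V₀.map SemidirectProduct.inl) W₀) :
    IsOpen (vBar₀ φ V₀ : Set (vBar φ)) := by
  convert hφ.isOpen.preimage (continuous_subtype_val (p := (· ∈ vBar φ)))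
  ext w
  exact mem_vBar₀_iff hφ w

theorem dense_toVBar (φ : V ⋊[α] G →* W) : Dense (Set.range (toVBar φ)) := by
  intro w
  rw [closure_subtype]
  refine closure_mono ?_ w.2
  rintro _ ⟨_, ⟨v, rfl⟩, rfl⟩
  exact ⟨toVBar φ v, ⟨v, rfl⟩, rfl⟩

theorem vBar₀_subset_closure
    (hφ : IsSchlichtingCompletion φ (V₀.map SemidirectProduct.inl) W₀) :
    (vBar₀ φ V₀ : Set (vBar φ)) ⊆ closure (toVBar φ '' (V₀ : Set V)) := by
  refine ((dense_toVBar φ).subset_closure_image_preimage (isOpen_vBar₀ hφ)).trans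
    (closure_mono (Set.image_mono fun v hv => ?_))
  exact (inl_mem_iff hφ v).1 ((mem_vBar₀_iff hφ _).1 hv)

/-- The image of `V₀ ⋊ Γ` normalizes `W₀`. -/
theorem conj_mem_of_mem_semidirectSubgroup {Γ : Subgroup G}
    {hinv : ∀ γ ∈ Γ, ∀ v ∈ V₀, α γ v ∈ V₀}
    (hφ : IsSchlichtingCompletion φ (V₀.map SemidirectProduct.inl) W₀) {k : V ⋊[α] G}
    (hk : k ∈ semidirectSubgroup α V₀ Γ hinv) {w : W} (hw : w ∈ W₀) :
    φ k * w * (φ k)⁻¹ ∈ W₀ := by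
  have hcl : closure (W₀ : Set W) = W₀ := (W₀.isClosed_of_isOpen hφ.isOpen).closure_eq
  change _ ∈ (W₀ : Set W)
  rw [← hcl]
  refine map_mem_closure (f := fun w => φ k * w * (φ k)⁻¹) (by fun_prop)
    (hφ.subset_closure hw) ?_
  rintro _ ⟨_, ⟨v, hv, rfl⟩, rfl⟩
  have : k * SemidirectProduct.inl v * k⁻¹ =
      SemidirectProduct.inl (k.left * α k.right v * k.left⁻¹) := by
    ext <;> simp [mul_assoc]
  change φ k * φ (SemidirectProduct.inl v) * (φ k)⁻¹ ∈ W₀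
  rw [← map_inv, ← map_mul, ← map_mul, this, inl_mem_iff hφ]
  exact V₀.mul_mem (V₀.mul_mem hk.1 (hinv _ hk.2 _ hv)) (V₀.inv_mem hk.1)

/-- The automorphisms `Ad γ`, for `γ ∈ Γ`, are equicontinuous. -/
theorem exists_nhds_conj_mem {Γ : Subgroup G} {hinv : ∀ γ ∈ Γ, ∀ v ∈ V₀, α γ v ∈ V₀}
    (hHecke : IsHeckePair (semidirectSubgroup α V₀ Γ hinv))
    (hφ : IsSchlichtingCompletion φ (V₀.map SemidirectProduct.inl) W₀)
    {U : Set W} (hU : U ∈ 𝓝 (1 : W)) :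
    ∃ O ∈ 𝓝 (1 : W), ∀ k ∈ semidirectSubgroup α V₀ Γ hinv, ∀ u ∈ O,
      φ k * u * (φ k)⁻¹ ∈ U := by
  obtain ⟨F, hF⟩ := hφ.exists_finset_subset hU
  choose s hs using hHecke.exists_finset
  refine ⟨⋂ n ∈ F, ⋂ y ∈ s n, {u | (φ (y * n))⁻¹ * u * φ (y * n) ∈ W₀}, ?_, ?_⟩
  · refine (Filter.biInter_finset_mem _).2 fun n _ => (Filter.biInter_finset_mem _).2 fun y _ => ?_
    refine (hφ.isOpen.preimage (f := fun u => (φ (y * n))⁻¹ * u * φ (y * n))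
      (by fun_prop)).mem_nhds ?_
    simp [W₀.one_mem]
  · intro k hk u hu
    refine hF _ fun n hn => ?_
    -- Modulo `V₀ ⋊ Γ`, which normalizes `W₀`, the element `k⁻¹ * n` may be replaced by `y * n`,
    -- leaving finitely many conditions on `u`.
    obtain ⟨y, hy, hyn⟩ := hs n k⁻¹ (inv_mem hk)
    have hu' : (φ (y * n))⁻¹ * u * φ (y * n) ∈ W₀ :=
      Set.mem_iInter₂.1 (Set.mem_iInter₂.1 hu n hn) y hy
    have := conj_mem_of_mem_semidirectSubgroup hφ (inv_mem hyn) hu'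
    simpa [mul_assoc] using this

/-- Turns finiteness of cosets of `V₀ ⋊ Γ` into finiteness of cosets of `V₀`: `x.right` is forced
into `Γ`, so its action on the left component can be undone inside `V₀`. -/
theorem left_mem_of_inv_mul_mem {Γ : Subgroup G} {hinv : ∀ γ ∈ Γ, ∀ v ∈ V₀, α γ v ∈ V₀}
    {x z : V ⋊[α] G} (h : x⁻¹ * z ∈ semidirectSubgroup α V₀ Γ hinv) (hz : z.right ∈ Γ) :
    x.left⁻¹ * z.left ∈ V₀ := by
  obtain ⟨h1, h2⟩ := h
  have hx : x.right ∈ Γ := by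
    have := Γ.mul_mem hz (Γ.inv_mem h2)
    simpa using this
  have := hinv _ hx _ h1
  simpa [mul_assoc] using this

/-- The orbits of `Γ` on `V̄` are relatively compact. -/
theorem exists_isCompact_conj_mem {Γ : Subgroup G} {hinv : ∀ γ ∈ Γ, ∀ v ∈ V₀, α γ v ∈ V₀}
    (hHecke : IsHeckePair (semidirectSubgroup α V₀ Γ hinv))
    (hφ : IsSchlichtingCompletion φ (V₀.map SemidirectProduct.inl) W₀) {w : W}
    (hw : w ∈ vBar φ) :
    ∃ K : Set W, IsCompact K ∧
      ∀ γ ∈ Γ, φ (SemidirectProduct.inr γ) * w * (φ (SemidirectProduct.inr γ))⁻¹ ∈ K := by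
  obtain ⟨v, hv⟩ := (dense_toVBar φ).exists_inv_mul_mem (isOpen_vBar₀ hφ) ⟨w, hw⟩
  have hv' : w⁻¹ * φ (SemidirectProduct.inl v) ∈ W₀ := (mem_vBar₀_iff hφ _).1 hv
  obtain ⟨s, hs⟩ := hHecke.exists_finset (SemidirectProduct.inl v)
  set f : V ⋊[α] G → W := fun y => φ (SemidirectProduct.inl (y * SemidirectProduct.inl v).left)
  refine ⟨⋃ y ∈ s, (fun u => f y * u) '' (W₀ : Set W),
    s.isCompact_biUnion fun y _ => hφ.isCompact.image (continuous_const_mul _), ?_⟩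
  intro γ hγ
  have hk : (SemidirectProduct.inr γ : V ⋊[α] G) ∈ semidirectSubgroup α V₀ Γ hinv :=
    ⟨V₀.one_mem, hγ⟩
  obtain ⟨y, hy, h⟩ := hs _ hk
  refine Set.mem_iUnion₂.2 ⟨y, hy, _, ?_, mul_inv_cancel_left _ _⟩
  -- With `w ∈ v W₀`, the conjugate of `w` by `γ` lies in `γ(v) W₀`, which equals `f y * W₀`.
  have h0 := left_mem_of_inv_mul_mem h (by simpa using hγ)
  have h1 := (inl_mem_iff hφ _).2 h0
  have h2 := conj_mem_of_mem_semidirectSubgroup hφ hk (inv_mem hv')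
  have h3 := mul_mem h1 h2
  have h4 : (SemidirectProduct.inr γ * SemidirectProduct.inl v : V ⋊[α] G).left = α γ v := by simp
  rw [h4, map_mul, SemidirectProduct.inl_aut, map_inv] at h3
  simp only [map_mul, map_inv, mul_inv_rev, inv_inv, mul_assoc, mul_inv_cancel_left, inv_mul_cancel_left] at h3
  simpa only [mul_assoc, SetLike.mem_coe] using h3

end

theorem inv_mul_mul_mul_eq {H : Type*} [Group H] (a x y : H) :
    (a * y)⁻¹ * x * (a * y) = y⁻¹ * (a⁻¹ * x * a) * y := by
  group

/-! ### Separating points of `W` by conjugation with `G` -/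

section

variable {V G W : Type*} [Group V] [Group G] {α : G →* MulAut V}
  [Group W] [TopologicalSpace W] [IsTopologicalGroup W]
  {V₀ : Subgroup V} {W₀ : Subgroup W} {φ : V ⋊[α] G →* W}
  {Γ : Subgroup G} {hinv : ∀ γ ∈ Γ, ∀ v ∈ V₀, α γ v ∈ V₀}

/-- The condition on `V` says that conjugation by `G` suffices to separate points of `W`. -/
theorem conj_mem_of_forall_inr (hφ : IsSchlichtingCompletion φ (V₀.map SemidirectProduct.inl) W₀)
    (hV : ∀ v : V, ∃ s : Finset G,
      (⨅ g ∈ s, V₀.map (α g).toMonoidHom) ≤ V₀.map (MulAut.conj v).toMonoidHom)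
    {w : W} (hw : ∀ g : G,
      (φ (SemidirectProduct.inr g))⁻¹ * w * φ (SemidirectProduct.inr g) ∈ W₀) (v : V) :
    (φ (SemidirectProduct.inl v))⁻¹ * w * φ (SemidirectProduct.inl v) ∈ W₀ := by
  obtain ⟨s, hs⟩ := hV v
  have hclosed := (W₀.isClosed_of_isOpen hφ.isOpen).preimage
    (f := fun w => (φ (SemidirectProduct.inl v))⁻¹ * w * φ (SemidirectProduct.inl v))
    (by fun_prop)
  -- The image of `V ⋊ G` is dense in this open set, so the inclusion need only be checked there.
  -- The factor `W₀` ensures that the elements involved come from `V₀`.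
  have hopen : IsOpen ((W₀ : Set W) ∩ ⋂ g ∈ s, {w : W |
      (φ (SemidirectProduct.inr g))⁻¹ * w * φ (SemidirectProduct.inr g) ∈ W₀}) :=
    hφ.isOpen.inter (isOpen_biInter_finset fun g _ => hφ.isOpen.preimage
      (f := fun w => (φ (SemidirectProduct.inr g))⁻¹ * w * φ (SemidirectProduct.inr g))
      (by fun_prop))
  refine closure_minimal ?_ hclosed (hφ.dense.subset_closure_image_preimage hopen
    ⟨by simpa using hw 1, Set.mem_iInter₂.2 fun g _ => hw g⟩)
  rintro _ ⟨n, ⟨hn0, hn⟩, rfl⟩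
  obtain ⟨u, -, rfl⟩ : n ∈ V₀.map SemidirectProduct.inl := hφ.comap_eq.le hn0
  have hu : u ∈ ⨅ g ∈ s, V₀.map (α g).toMonoidHom := by
    refine Subgroup.mem_iInf.2 fun g => Subgroup.mem_iInf.2 fun hg => ?_
    have h1 : (φ (SemidirectProduct.inr g))⁻¹ * φ (SemidirectProduct.inl u) *
      φ (SemidirectProduct.inr g) ∈ W₀ := Set.mem_iInter₂.1 hn g hg
    rw [← map_inv, ← map_mul, ← map_mul, ← map_inv] at h1
    have h2 := SemidirectProduct.inl_aut (φ := α) g⁻¹ u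
    rw [inv_inv] at h2
    rw [← h2, inl_mem_iff hφ] at h1
    exact ⟨_, h1, by simp⟩
  obtain ⟨x, hx, hxu⟩ := hs hu
  have hx' : x = v⁻¹ * u * v := by
    rw [← hxu]
    simp [mul_assoc]
  change (φ (SemidirectProduct.inl v))⁻¹ * φ (SemidirectProduct.inl u) *
    φ (SemidirectProduct.inl v) ∈ W₀
  rw [← map_inv, ← map_mul, ← map_mul, ← map_inv, ← map_mul, ← map_mul, inl_mem_iff hφ, ← hx']
  exact hx

theorem eq_one_of_forall_inr (hφ : IsSchlichtingCompletion φ (V₀.map SemidirectProduct.inl) W₀)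
    (hV : ∀ v : V, ∃ s : Finset G,
      (⨅ g ∈ s, V₀.map (α g).toMonoidHom) ≤ V₀.map (MulAut.conj v).toMonoidHom)
    {w : W} (hw : ∀ g : G,
      (φ (SemidirectProduct.inr g))⁻¹ * w * φ (SemidirectProduct.inr g) ∈ W₀) : w = 1 := by
  refine hφ.reduced.eq_one_of_dense hφ.dense hφ.isOpen fun n => ?_
  -- Writing `n` with its `G`-factor first uses that the hypothesis on `w` is stable under
  -- conjugation by `G`.
  have hn : n = SemidirectProduct.inr n.right * SemidirectProduct.inl (α n.right⁻¹ n.left) := by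
    ext <;> simp
  have := conj_mem_of_forall_inr hφ hV
    (w := (φ (SemidirectProduct.inr n.right))⁻¹ * w * φ (SemidirectProduct.inr n.right))
    (fun g => by simpa [mul_assoc] using hw (n.right * g)) (α n.right⁻¹ n.left)
  rw [hn, map_mul]
  simpa only [mul_assoc, mul_inv_rev] using this

/-! ### Compactness and openness of `Γ̄` -/

variable [LocallyCompactSpace W]

theorem isCompact_closure_adHom (hHecke : IsHeckePair (semidirectSubgroup α V₀ Γ hinv))
    (hφ : IsSchlichtingCompletion φ (V₀.map SemidirectProduct.inl) W₀) :
    IsCompact (closure (adHom φ '' (Γ : Set G))) := by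
  have := hφ.t2Space
  have he : IsClosedEmbedding (Subtype.val : vBar φ → W) :=
    (Subgroup.isClosed_topologicalClosure _).isClosedEmbedding_subtypeVal
  refine HA.isCompact_closure ?_ ?_ ?_
  · rintro _ ⟨γ, hγ, rfl⟩
    exact ⟨γ⁻¹, Γ.inv_mem hγ, map_inv _ _⟩
  · intro w
    obtain ⟨K, hK, h⟩ := exists_isCompact_conj_mem hHecke hφ w.2
    refine ⟨_, he.isCompact_preimage hK, ?_⟩
    rintro _ ⟨γ, hγ, rfl⟩
    exact h γ hγ
  · intro U hU
    obtain ⟨U', hU', hUU'⟩ := mem_nhds_subtype _ _ _ |>.1 hU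
    obtain ⟨O, hO, h⟩ := exists_nhds_conj_mem hHecke hφ hU'
    refine ⟨Subtype.val ⁻¹' O, continuous_subtype_val.continuousAt.preimage_mem_nhds hO, ?_⟩
    rintro _ ⟨γ, hγ, rfl⟩ u hu
    exact hUU' (h (SemidirectProduct.inr γ) ⟨V₀.one_mem, hγ⟩ u hu)

variable {T : Type*} [Group T] [TopologicalSpace T] [IsTopologicalGroup T]
  {T₀ : Subgroup T} {ρT : G →* T}

theorem dense_toGBar (φ : V ⋊[α] G →* W) (ρT : G →* T) : Dense (Set.range (toGBar φ ρT)) := by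
  intro x
  rw [closure_subtype]
  refine closure_mono ?_ x.2
  rintro _ ⟨g, -, rfl⟩
  exact ⟨toGBar φ ρT g, ⟨g, rfl⟩, rfl⟩

/-- The second coordinate alone decides: as `T₀` is open, a point of `Ḡ` over `T₀` is a limit of
`ρ(g)` with `ρT g ∈ T₀`, that is, `g ∈ Γ`. -/
theorem mem_gammaBar_iff (hc : ρT ⁻¹' (T₀ : Set T) = Γ) (ho : IsOpen (T₀ : Set T))
    (x : gBar φ ρT) : x ∈ gammaBar φ ρT Γ ↔ x.1.2 ∈ T₀ := by
  constructor
  · intro hx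
    refine closure_minimal (t := Prod.snd ⁻¹' (T₀ : Set T)) ?_
      ((T₀.isClosed_of_isOpen ho).preimage continuous_snd) hx
    rintro _ ⟨g, hg, rfl⟩
    exact hc.ge hg
  · intro hx
    have h1 := (ho.preimage (continuous_snd (X := HA (vBar φ)))).closure_inter ⟨x.2, hx⟩
    refine closure_mono ?_ h1
    rintro _ ⟨⟨g, -, rfl⟩, hg⟩
    exact ⟨g, hc.le hg, rfl⟩

theorem coe_gammaBar (hc : ρT ⁻¹' (T₀ : Set T) = Γ) (ho : IsOpen (T₀ : Set T)) :
    (gammaBar φ ρT Γ : Set (gBar φ ρT)) = (fun x => x.1.2) ⁻¹' (T₀ : Set T) :=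
  Set.ext fun x => mem_gammaBar_iff hc ho x

theorem isOpen_gammaBar (hc : ρT ⁻¹' (T₀ : Set T) = Γ) (ho : IsOpen (T₀ : Set T)) :
    IsOpen (gammaBar φ ρT Γ : Set (gBar φ ρT)) := by
  rw [coe_gammaBar hc ho]
  exact ho.preimage (continuous_snd.comp continuous_subtype_val)

theorem isCompact_gammaBar (hHecke : IsHeckePair (semidirectSubgroup α V₀ Γ hinv))
    (hφ : IsSchlichtingCompletion φ (V₀.map SemidirectProduct.inl) W₀)
    (hc : ρT ⁻¹' (T₀ : Set T) = Γ) (ho : IsOpen (T₀ : Set T)) (hT : IsCompact (T₀ : Set T)) :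
    IsCompact (gammaBar φ ρT Γ : Set (gBar φ ρT)) := by
  have he : IsClosedEmbedding (Subtype.val : gBar φ ρT → HA (vBar φ) × T) :=
    (Subgroup.isClosed_topologicalClosure _).isClosedEmbedding_subtypeVal
  have hK := (isCompact_closure_adHom hHecke hφ).prod hT
  have hcl : IsClosed (closureImage (rhoHom φ ρT) Γ : Set (HA (vBar φ) × T)) :=
    Subgroup.isClosed_topologicalClosure _
  refine he.isCompact_preimage (hK.of_isClosed_subset hcl ?_)
  have := hφ.t2Space
  refine closure_minimal ?_ (isClosed_closure.prod (T₀.isClosed_of_isOpen ho))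
  rintro _ ⟨g, hg, rfl⟩
  exact ⟨subset_closure ⟨g, hg, rfl⟩, hc.ge hg⟩

theorem gammaBar_subset_closure (hc : ρT ⁻¹' (T₀ : Set T) = Γ) (ho : IsOpen (T₀ : Set T)) :
    (gammaBar φ ρT Γ : Set (gBar φ ρT)) ⊆ closure (toGBar φ ρT '' (Γ : Set G)) := by
  refine ((dense_toGBar φ ρT).subset_closure_image_preimage (isOpen_gammaBar hc ho)).trans
    (closure_mono (Set.image_mono fun g hg => ?_))
  exact hc.le ((mem_gammaBar_iff hc ho _).1 hg)

/-! ### The completed semidirect product -/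

theorem continuous_gBarAction (φ : V ⋊[α] G →* W) (ρT : G →* T) :
    Continuous fun p : gBar φ ρT × vBar φ => gBarAction φ ρT p.1 p.2 :=
  HA.continuous_eval.comp
    ((continuous_fst.comp (continuous_subtype_val.comp continuous_fst)).prodMk continuous_snd)

instance (φ : V ⋊[α] G →* W) (ρT : G →* T) :
    IsTopologicalGroup (vBar φ ⋊[gBarAction φ ρT] gBar φ ρT) :=
  SemidirectProduct.isTopologicalGroup_of_continuous (continuous_gBarAction φ ρT)

/-- On underlying sets `ι` is a product map, so density can be checked in each coordinate. -/
theorem image_iotaHom (φ : V ⋊[α] G →* W) (ρT : G →* T) (A : Set V) (B : Set G) :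
    iotaHom φ ρT '' {x | x.left ∈ A ∧ x.right ∈ B} = SemidirectProduct.homeomorphProd ⁻¹'
      ((toVBar φ '' A) ×ˢ (toGBar φ ρT '' B)) := by
  ext x
  constructor
  · rintro ⟨y, ⟨hA, hB⟩, rfl⟩
    exact ⟨⟨_, hA, rfl⟩, ⟨_, hB, rfl⟩⟩
  · rintro ⟨⟨v, hv, hv'⟩, ⟨g, hg, hg'⟩⟩
    exact ⟨⟨v, g⟩, ⟨hv, hg⟩, SemidirectProduct.ext hv' hg'⟩

theorem closure_image_iotaHom (φ : V ⋊[α] G →* W) (ρT : G →* T) (A : Set V) (B : Set G) :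
    closure (iotaHom φ ρT '' {x | x.left ∈ A ∧ x.right ∈ B}) =
      SemidirectProduct.homeomorphProd ⁻¹'
        (closure (toVBar φ '' A) ×ˢ closure (toGBar φ ρT '' B)) := by
  rw [image_iotaHom, ← Homeomorph.preimage_closure, closure_prod_eq]

theorem mem_completedSubgroup_iff
    (hφ : IsSchlichtingCompletion φ (V₀.map SemidirectProduct.inl) W₀)
    (hc : ρT ⁻¹' (T₀ : Set T) = Γ) (ho : IsOpen (T₀ : Set T))
    (x : vBar φ ⋊[gBarAction φ ρT] gBar φ ρT) :
    x ∈ completedSubgroup φ ρT V₀ Γ hinv ↔ (x.left : W) ∈ W₀ ∧ x.right.1.2 ∈ T₀ :=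
  and_congr (mem_vBar₀_iff hφ _) (mem_gammaBar_iff hc ho _)

theorem isCompletion_iotaHom (hHecke : IsHeckePair (semidirectSubgroup α V₀ Γ hinv))
    (hφ : IsSchlichtingCompletion φ (V₀.map SemidirectProduct.inl) W₀)
    (hρT : IsCompletion ρT Γ T₀) :
    IsCompletion (iotaHom φ ρT) (semidirectSubgroup α V₀ Γ hinv)
      (completedSubgroup φ ρT V₀ Γ hinv) := by
  have := hφ.t2Space
  have := hρT.t2Space
  have hc : ρT ⁻¹' (T₀ : Set T) = Γ := congrArg SetLike.coe hρT.comap_eq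
  have ho := hρT.isOpen
  have hcompact : IsCompact (completedSubgroup φ ρT V₀ Γ hinv :
      Set (vBar φ ⋊[gBarAction φ ρT] gBar φ ρT)) :=
    SemidirectProduct.homeomorphProd.isClosedEmbedding.isCompact_preimage
      ((isCompact_vBar₀ hφ).prod (isCompact_gammaBar hHecke hφ hc ho hρT.isCompact))
  have hopen : IsOpen (completedSubgroup φ ρT V₀ Γ hinv :
      Set (vBar φ ⋊[gBarAction φ ρT] gBar φ ρT)) :=
    ((isOpen_vBar₀ hφ).prod (isOpen_gammaBar hc ho)).preimage
      SemidirectProduct.homeomorphProd.continuous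
  have hcomap : (completedSubgroup φ ρT V₀ Γ hinv).comap (iotaHom φ ρT) =
      semidirectSubgroup α V₀ Γ hinv := by
    ext x
    rw [Subgroup.mem_comap, mem_completedSubgroup_iff hφ hc ho]
    exact and_congr (inl_mem_iff hφ _) (Set.ext_iff.1 hc x.right)
  refine ⟨inferInstance, inferInstance,
    hcompact.locallyCompactSpace_of_mem_nhds_of_group (hopen.mem_nhds (one_mem _)),
    hcompact, hopen, ?_, ?_, ?_, hcomap⟩
  · have := closure_image_iotaHom φ ρT Set.univ Set.univ
    simp only [Set.mem_univ, and_self, Set.ofPred_true, Set.image_univ,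
      (dense_toVBar φ).closure_eq, (dense_toGBar φ ρT).closure_eq, Set.univ_prod_univ,
      Set.preimage_univ] at this
    exact dense_iff_closure_eq.2 this
  · rw [Subgroup.map_le_iff_le_comap, hcomap]
  · exact (closure_image_iotaHom φ ρT (V₀ : Set V) (Γ : Set G)).ge.trans' fun x hx =>
      ⟨vBar₀_subset_closure hφ hx.1, gammaBar_subset_closure hc ho hx.2⟩

theorem isReducedPair_completedSubgroup
    (hφ : IsSchlichtingCompletion φ (V₀.map SemidirectProduct.inl) W₀)
    (hρT : IsSchlichtingCompletion ρT Γ T₀)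
    (hV : ∀ v : V, ∃ s : Finset G,
      (⨅ g ∈ s, V₀.map (α g).toMonoidHom) ≤ V₀.map (MulAut.conj v).toMonoidHom) :
    IsReducedPair (completedSubgroup φ ρT V₀ Γ hinv) := by
  have hc : ρT ⁻¹' (T₀ : Set T) = Γ := congrArg SetLike.coe hρT.comap_eq
  -- Conjugating by `G` does not see the automorphism part of `x`, so only the other two components
  -- are determined here.
  have key : ∀ x : vBar φ ⋊[gBarAction φ ρT] gBar φ ρT,
      (∀ y, y⁻¹ * x * y ∈ completedSubgroup φ ρT V₀ Γ hinv) →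
        x.left = 1 ∧ x.right.1.2 = 1 := by
    intro x hx
    have hx' (g : G) := (mem_completedSubgroup_iff hφ hc hρT.isOpen _).1
      (hx (SemidirectProduct.inr (toGBar φ ρT g)))
    constructor
    · refine Subtype.ext (eq_one_of_forall_inr hφ hV fun g => ?_)
      have h1 := (hx' g).1
      simp only [SemidirectProduct.mul_left, SemidirectProduct.inv_left,
        SemidirectProduct.inv_right, SemidirectProduct.left_inr, SemidirectProduct.right_inr,
        SemidirectProduct.mul_right, inv_one, map_one, one_mul, mul_one] at h1
      rw [← map_inv] at h1
      have h2 : ((gBarAction φ ρT (toGBar φ ρT g⁻¹) x.left : vBar φ) : W) =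
        φ (SemidirectProduct.inr g⁻¹) * x.left * (φ (SemidirectProduct.inr g⁻¹))⁻¹ := rfl
      rw [h2] at h1
      simpa using h1
    · exact hρT.reduced.eq_one_of_dense hρT.dense hρT.isOpen fun g => (hx' g).2
  refine isReducedPair_of_forall fun x hx => ?_
  obtain ⟨hl, hr⟩ := key x hx
  refine SemidirectProduct.ext hl (Subtype.ext (Prod.ext (Subtype.ext (MulEquiv.ext fun u => ?_))
    hr))
  -- The conjugate also lies in every conjugate of the subgroup. Its left component is `u⁻¹ * β(u)`,
  -- with `β` the automorphism part of `x`; as this is `1`, `β` fixes `u`.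
  have h1 := (key ((SemidirectProduct.inl u)⁻¹ * x * SemidirectProduct.inl u) fun y =>
    inv_mul_mul_mul_eq (SemidirectProduct.inl u) x y ▸ hx (SemidirectProduct.inl u * y)).1
  simp only [SemidirectProduct.mul_left, SemidirectProduct.inv_left,
    SemidirectProduct.inv_right, SemidirectProduct.left_inl, SemidirectProduct.right_inl,
    SemidirectProduct.mul_right, inv_one, map_one, one_mul, hl, mul_one,
    MulAut.one_apply] at h1
  exact (inv_mul_eq_one.1 h1).symm

theorem totallyDisconnectedSpace_completion
    (hφ : IsSchlichtingCompletion φ (V₀.map SemidirectProduct.inl) W₀)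
    (hρT : IsSchlichtingCompletion ρT Γ T₀) :
    TotallyDisconnectedSpace (vBar φ ⋊[gBarAction φ ρT] gBar φ ρT) := by
  have := hφ.totallyDisconnectedSpace
  have := hρT.totallyDisconnectedSpace
  exact .of_injective SemidirectProduct.homeomorphProd.continuous
    SemidirectProduct.homeomorphProd.injective

theorem isSchlichtingCompletion_iotaHom
    (hHecke : IsHeckePair (semidirectSubgroup α V₀ Γ hinv))
    (hφ : IsSchlichtingCompletion φ (V₀.map SemidirectProduct.inl) W₀)
    (hρT : IsCompletion ρT Γ T₀) (hρT' : IsSchlichtingCompletion ρT Γ T₀)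
    (hV : ∀ v : V, ∃ s : Finset G,
      (⨅ g ∈ s, V₀.map (α g).toMonoidHom) ≤ V₀.map (MulAut.conj v).toMonoidHom) :
    IsSchlichtingCompletion (iotaHom φ ρT) (semidirectSubgroup α V₀ Γ hinv)
      (completedSubgroup φ ρT V₀ Γ hinv) := by
  have h := isCompletion_iotaHom hHecke hφ hρT
  exact ⟨h.isTopologicalGroup, h.t2Space, h.locallyCompactSpace,
    totallyDisconnectedSpace_completion hφ hρT', h.isCompact, h.isOpen,
    isReducedPair_completedSubgroup hφ hρT' hV, h.dense, h.comap_eq⟩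

end

end

theorem theorem2 {V : Type*} {G : Type*} [Group V] [Group G] (α : G →* MulAut V)
    (V₀ : Subgroup V) (Γ : Subgroup G) (hinv : ∀ γ ∈ Γ, ∀ v ∈ V₀, α γ v ∈ V₀)
    (hHecke : IsHeckePair (semidirectSubgroup α V₀ Γ hinv))
    (hred : IsReducedPair (semidirectSubgroup α V₀ Γ hinv))
    -- the Schlichting completion of `(V ⋊ G, V₀)`
    {W : Type*} [Group W] [TopologicalSpace W] [IsTopologicalGroup W] [LocallyCompactSpace W]
    (W₀ : Subgroup W) (φ : V ⋊[α] G →* W)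
    (hφ : IsSchlichtingCompletion φ (V₀.map SemidirectProduct.inl) W₀)
    -- a completion of `(G, Γ)`
    {T : Type*} [Group T] [TopologicalSpace T] [IsTopologicalGroup T]
    (T₀ : Subgroup T) (ρT : G →* T) (hρT : IsCompletion ρT Γ T₀) :
    IsCompletion (iotaHom φ ρT) (semidirectSubgroup α V₀ Γ hinv)
        (completedSubgroup φ ρT V₀ Γ hinv) ∧
      (IsSchlichtingCompletion ρT Γ T₀ →
        (∀ v : V, ∃ s : Finset G,
          (⨅ g ∈ s, V₀.map (α g).toMonoidHom) ≤ V₀.map (MulAut.conj v).toMonoidHom) →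
        IsSchlichtingCompletion (iotaHom φ ρT) (semidirectSubgroup α V₀ Γ hinv)
            (completedSubgroup φ ρT V₀ Γ hinv) ∧
          ∀ {P : Type*} [Group P] [TopologicalSpace P] (P₀ : Subgroup P) (θ : V ⋊[α] G →* P),
            IsSchlichtingCompletion θ (semidirectSubgroup α V₀ Γ hinv) P₀ →
            ∃ Φ : P ≃ₜ* vBar φ ⋊[gBarAction φ ρT] gBar φ ρT,
              (∀ x, Φ (θ x) = iotaHom φ ρT x) ∧
                P₀.map Φ.toMulEquiv.toMonoidHom = completedSubgroup φ ρT V₀ Γ hinv) := by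
  have h := isCompletion_iotaHom hHecke hφ hρT
  refine ⟨h, fun hρT' hV => ?_⟩
  have hS := isSchlichtingCompletion_iotaHom hHecke hφ hρT hρT' hV
  refine ⟨hS, fun P₀ θ hθ => ?_⟩
  have := hθ.isTopologicalGroup
  exact hθ.exists_continuousMulEquiv hS
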